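/- Let $\lambda>0$, let $w\ge 1$, and let $X=\{X_i\}_{i\ge1}$ be a homogeneous Poisson point process of intensity $\lambda$ on $[0,\infty)$, with its points ordered so that $X_1\le X_2\le\cdots$. Let $E_0$ be the event that the Gilbert graph on $X\cap[0,w]$ has no edges, where the Gilbert graph on a set of points joins two distinct points by an edge if their distance is at most $1$; thus $E_0$ is the event that no two distinct points of $X\cap[0,w]$ are at distance at most $1$. Define recursively $X_1^*=X_1$ and $$X_{m+1}^*=\inf\{X_i\in X:\ X_i\ge X_m^*+1\},\qquad m\ge1,$$ let $\mathcal F^*=\sigma(X_1^*,X_2^*,\dots)$, and put $$I_*=\sup\{i\ge1:\ X_i^*\le w\},\qquad X_*=X_{I_*}^*,$$ with $I_*=0$ and $X_*=w$ if $X_1>w$. Then $$\mathbb P(E_0\mid\mathcal F^*)=\exp\bigl(-\lambda\,\bigl((I_*-1)_+ + (w-X_*)\wedge1\bigr)\bigr)\quad\text{almost surely.}$$ -/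

import Mathlib

open MeasureTheory ProbabilityTheory
open scoped NNReal

/-- The Gilbert graph with threshold `1` on a set `S` of points: the nodes are the points of `S`,
and two distinct points are joined by an edge if their distance is at most `1`. -/
def gilbertGraph {E : Type*} [MetricSpace E] (S : Set E) : SimpleGraph S where
  Adj x y := x ≠ y ∧ dist (x : E) (y : E) ≤ 1
  symm := ⟨fun x y h => ⟨h.1.symm, by rw [dist_comm]; exact h.2⟩⟩
  loopless := ⟨fun _ h => h.1 rfl⟩

/-- The number of points of the sequence `X 0 ω, X 1 ω, …` that lie in `B`. -/
noncomputable def pointCount {Ω : Type*} (X : ℕ → Ω → ℝ) (B : Set ℝ) (ω : Ω) : ℕ∞ :=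
  {i : ℕ | X i ω ∈ B}.encard

/-- The random points `X 0, X 1, …` form a homogeneous Poisson point process on `[0, ∞)` with
intensity `rate`: the number of points in a Borel set `B ⊆ [0, ∞)` of finite Lebesgue measure
is Poisson distributed with parameter `rate * |B|`, and the numbers of points in pairwise disjoint
Borel sets are independent. -/
structure IsHomogeneousPoissonProcess {Ω : Type*} [MeasurableSpace Ω] (P : Measure Ω)
    (rate : ℝ≥0) (X : ℕ → Ω → ℝ) : Prop where
  measurable : ∀ i, Measurable (X i)
  nonneg : ∀ i ω, 0 ≤ X i ω
  hasLaw_pointCount : ∀ B : Set ℝ, MeasurableSet B → B ⊆ Set.Ici 0 → volume B ≠ ⊤ →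
    HasLaw (pointCount X B)
      ((poissonMeasure (rate * (volume B).toNNReal)).map (fun n : ℕ => (n : ℕ∞))) P
  iIndepFun_pointCount : ∀ (n : ℕ) (B : Fin n → Set ℝ), (∀ j, MeasurableSet (B j)) →
    (∀ j, B j ⊆ Set.Ici 0) → Pairwise (fun j k => Disjoint (B j) (B k)) →
    iIndepFun (fun j => pointCount X (B j)) P

/-- The event that the Gilbert graph on the points of `X` in the window `[0, w]` has at most
`k` edges. -/
def atMostEdges {Ω : Type*} (X : ℕ → Ω → ℝ) (w : ℝ) (k : ℕ) : Set Ω :=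
  {ω | (gilbertGraph (Set.range (fun i => X i ω) ∩ Set.Icc 0 w)).edgeSet.encard ≤ k}

/-- The points `X₁* ≤ X₂* ≤ ⋯`, where `X_m*` is `starPoint X (m - 1)`: `X₁*` is the left-most point
`X 0` of the ordered sequence `X`, and the next point is the first point of `X` at or beyond the
previous one plus `1`. -/
noncomputable def starPoint {Ω : Type*} (X : ℕ → Ω → ℝ) : ℕ → Ω → ℝ
  | 0, ω => X 0 ω
  | m + 1, ω => sInf {x : ℝ | x ∈ Set.range (fun i => X i ω) ∧ starPoint X m ω + 1 ≤ x}

/-- The last index `I_* = sup {i ≥ 1 : X_i* ≤ w}`, with `I_* = 0` if the first point exceeds `w`. -/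
noncomputable def starLastIndex {Ω : Type*} (X : ℕ → Ω → ℝ) (w : ℝ) (ω : Ω) : ℕ :=
  open Classical in
  if w < X 0 ω then 0 else sSup {i : ℕ | 1 ≤ i ∧ starPoint X (i - 1) ω ≤ w}

/-- The last point `X_* = X_{I_*}*`, with `X_* = w` if the first point exceeds `w`. -/
noncomputable def starLastPoint {Ω : Type*} (X : ℕ → Ω → ℝ) (w : ℝ) (ω : Ω) : ℝ :=
  open Classical in
  if w < X 0 ω then w else starPoint X (starLastIndex X w ω - 1) ω

/-- The σ-algebra `σ(X₁*, X₂*, …)`. -/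
@[reducible]
noncomputable def starSigmaAlgebra {Ω : Type*} (X : ℕ → Ω → ℝ) : MeasurableSpace Ω :=
  ⨆ m : ℕ, MeasurableSpace.comap (starPoint X m) inferInstance

/-! The points `X_m*` are found by scanning from the left and jumping ahead by 1 after each find.
The scan never looks into the gaps `(X_m*, X_m* + 1)`, so given the `X_m*` the process there is
still Poisson. Up to null sets, `E_0` says that the parts of these gaps below `w` are empty. Their
total length is `(I_* - 1)_+ + min (w - X_*) 1` (`gapLength_starPoint_eq`), whence the exponential.

Conditioning on a continuous law is avoided by discretization. Cut the half-line into cells of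
length `1 / K`; the occupied cells form a Bernoulli set (`measure_occupiedCells`). Prescribing its
first `n` greedy `K`-separated points fixes the state of finitely many cells, none of them in a gap,
so the gaps are empty with conditional probability `q ^ card` (`measure_greedy_eq_inter_voidGaps`),
where `q = exp (-rate / K)`. This is an identity between integrals of any function of the greedy
points.

As `K → ∞`, almost surely the rescaled greedy points tend to the `X_m*`, the void-gap event becomes
`E_0` (`eventually_mem_voidGaps_iff`), and the number of gap cells over `K` tends to the gap length
(`tendsto_card_gapPositions_div`). Dominated convergence gives the identity for bounded continuous
functions of finitely many `X_m*`, hence an equality of measures on sequence space, which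
characterizes the conditional expectation. -/

/-! ### Greedy points of a set of natural numbers -/

/-- The greedy `K`-separated points of `S`: the least element of `S`, and then repeatedly the least
element of `S` that exceeds the previous point by at least `K`. -/
noncomputable def greedy (K : ℕ) (S : Set ℕ) : ℕ → ℕ
  | 0 => sInf S
  | m + 1 => sInf {s : ℕ | s ∈ S ∧ greedy K S m + K ≤ s}

/-- The position from which the search for the `m`-th greedy point starts, if the points are `y`. -/
def searchStart (K : ℕ) (y : ℕ → ℕ) : ℕ → ℕ
  | 0 => 0
  | m + 1 => y m + K

lemma greedy_eq_sInf (K : ℕ) (S : Set ℕ) (m : ℕ) :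
    greedy K S m = sInf {s : ℕ | s ∈ S ∧ searchStart K (greedy K S) m ≤ s} := by
  cases m <;> simp [greedy, searchStart]

/-- Infinitude keeps the set nonempty, so the infimum is a true minimum and not the default value 0.
-/
lemma sInf_mem_ge_eq_iff {S : Set ℕ} (hS : S.Infinite) (a b : ℕ) :
    sInf {s : ℕ | s ∈ S ∧ a ≤ s} = b ↔
      a ≤ b ∧ b ∈ S ∧ ∀ j, a ≤ j → j < b → j ∉ S := by
  have hne : {s : ℕ | s ∈ S ∧ a ≤ s}.Nonempty := by
    obtain ⟨s, hs, has⟩ := hS.exists_gt a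
    exact ⟨s, hs, has.le⟩
  constructor
  · rintro rfl
    obtain ⟨h1, h2⟩ := Nat.sInf_mem hne
    refine ⟨h2, h1, fun j haj hj hjS => ?_⟩
    exact Nat.notMem_of_lt_sInf hj ⟨hjS, haj⟩
  · rintro ⟨h1, h2, h3⟩
    refine IsLeast.csInf_eq ⟨⟨h2, h1⟩, fun s hs => ?_⟩
    by_contra hlt
    exact h3 s hs.2 (not_le.mp hlt) hs.1

lemma greedy_spec (K : ℕ) {S : Set ℕ} (hS : S.Infinite) (m : ℕ) :
    searchStart K (greedy K S) m ≤ greedy K S m ∧ greedy K S m ∈ S ∧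
      ∀ j, searchStart K (greedy K S) m ≤ j → j < greedy K S m → j ∉ S :=
  (sInf_mem_ge_eq_iff hS _ _).1 (greedy_eq_sInf K S m).symm

/-- Removes the recursion: each search may start from the prescribed `y` instead of the greedy
points, which agree with it by induction. -/
lemma greedy_eq_iff (K n : ℕ) {S : Set ℕ} (hS : S.Infinite) (y : ℕ → ℕ) :
    (∀ m < n, greedy K S m = y m) ↔
      ∀ m < n, searchStart K y m ≤ y m ∧ y m ∈ S ∧
        ∀ j, searchStart K y m ≤ j → j < y m → j ∉ S := by
  constructor
  · intro h m hm
    have hs : searchStart K (greedy K S) m = searchStart K y m := by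
      cases m with
      | zero => rfl
      | succ m => simp [searchStart, h m (by omega)]
    have := greedy_spec K hS m
    rwa [hs, h m hm] at this
  · intro h m
    induction m with
    | zero =>
      intro hm
      rw [greedy_eq_sInf]
      exact (sInf_mem_ge_eq_iff hS _ _).2 (h 0 hm)
    | succ m ih =>
      intro hm
      rw [greedy_eq_sInf]
      refine (sInf_mem_ge_eq_iff hS _ _).2 ?_
      have := h (m + 1) hm
      simpa only [searchStart, ih (by omega)] using this

lemma add_le_of_lt_of_searchStart_le {K : ℕ} {y : ℕ → ℕ} (hy : ∀ m, searchStart K y m ≤ y m)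
    {a b : ℕ} (hab : a < b) : y a + K ≤ searchStart K y b := by
  induction b, hab using Nat.le_induction with
  | base => simp [searchStart]
  | succ b hb ih =>
    have := hy b
    simp only [searchStart]
    omega

lemma monotone_of_searchStart_le {K : ℕ} {y : ℕ → ℕ} (hy : ∀ m, searchStart K y m ≤ y m) :
    Monotone y := by
  refine monotone_nat_of_le_succ fun m => ?_
  have := hy (m + 1)
  simp only [searchStart] at this
  omega

/-- The positions strictly within distance `K` to the right of one of the points `y m`, `m < n`, and
below `L`. -/
def gapPositions (K L n : ℕ) (y : ℕ → ℕ) : Finset ℕ :=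
  (Finset.range n).biUnion fun m => Finset.Ico (y m + 1) (min (y m + K) L)

/-- The positions passed over in the search for the points `y m`, `m < n`. -/
def skippedPositions (K n : ℕ) (y : ℕ → ℕ) : Finset ℕ :=
  (Finset.range n).biUnion fun m => Finset.Ico (searchStart K y m) (y m)

lemma card_gapPositions {K : ℕ} (L n : ℕ) {y : ℕ → ℕ} (hy : ∀ m, searchStart K y m ≤ y m) :
    (gapPositions K L n y).card = ∑ m ∈ Finset.range n, (min (y m + K) L - (y m + 1)) := by
  rw [gapPositions, Finset.card_biUnion]
  · simp
  · intro a _ b _ hab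
    refine Finset.disjoint_left.2 fun j hja hjb => ?_
    simp only [Finset.mem_Ico, lt_min_iff] at hja hjb
    rcases lt_or_gt_of_ne hab with h | h
    · have := add_le_of_lt_of_searchStart_le hy h
      have := hy b
      omega
    · have := add_le_of_lt_of_searchStart_le hy h
      have := hy a
      omega

lemma disjoint_image_skippedPositions {K : ℕ} (hK : 0 < K) (n : ℕ) {y : ℕ → ℕ}
    (hy : ∀ m, searchStart K y m ≤ y m) :
    Disjoint ((Finset.range n).image y) (skippedPositions K n y) := by
  rw [Finset.disjoint_left]
  intro j hja hjb
  simp only [skippedPositions, Finset.mem_image, Finset.mem_biUnion, Finset.mem_Ico] at hja hjb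
  obtain ⟨a, -, rfl⟩ := hja
  obtain ⟨b, -, h1, h2⟩ := hjb
  rcases lt_or_ge a b with h | h
  · have := add_le_of_lt_of_searchStart_le hy h
    omega
  · have := monotone_of_searchStart_le hy h
    omega

lemma disjoint_image_gapPositions {K : ℕ} (L n : ℕ) {y : ℕ → ℕ}
    (hy : ∀ m, searchStart K y m ≤ y m) :
    Disjoint ((Finset.range n).image y) (gapPositions K L n y) := by
  rw [Finset.disjoint_left]
  intro j hja hjb
  simp only [gapPositions, Finset.mem_image, Finset.mem_biUnion, Finset.mem_Ico, lt_min_iff]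
    at hja hjb
  obtain ⟨a, -, rfl⟩ := hja
  obtain ⟨b, -, h1, h2, -⟩ := hjb
  rcases lt_or_ge b a with h | h
  · have := add_le_of_lt_of_searchStart_le hy h
    have := hy a
    omega
  · have := monotone_of_searchStart_le hy h
    omega

lemma disjoint_skippedPositions_gapPositions {K : ℕ} (L n : ℕ) {y : ℕ → ℕ}
    (hy : ∀ m, searchStart K y m ≤ y m) :
    Disjoint (skippedPositions K n y) (gapPositions K L n y) := by
  rw [Finset.disjoint_left]
  intro j hja hjb
  simp only [gapPositions, skippedPositions, Finset.mem_biUnion, Finset.mem_Ico, lt_min_iff]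
    at hja hjb
  obtain ⟨a, -, h3, h4⟩ := hja
  obtain ⟨b, -, h1, h2, -⟩ := hjb
  rcases lt_or_ge b a with h | h
  · have := add_le_of_lt_of_searchStart_le hy h
    omega
  · have := monotone_of_searchStart_le hy h
    omega

/-- Exhibits the event as a cylinder event, whose probability under a Bernoulli law is explicit. -/
lemma greedy_eq_iff_image_skippedPositions (K n : ℕ) {S : Set ℕ} (hS : S.Infinite) {y : ℕ → ℕ}
    (hy : ∀ m, searchStart K y m ≤ y m) :
    (∀ m < n, greedy K S m = y m) ↔
      (∀ j ∈ (Finset.range n).image y, j ∈ S) ∧ ∀ j ∈ skippedPositions K n y, j ∉ S := by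
  refine (greedy_eq_iff K n hS y).trans ?_
  simp only [skippedPositions, Finset.mem_biUnion, Finset.mem_Ico, Finset.mem_image,
    Finset.mem_range]
  constructor
  · intro h
    refine ⟨?_, ?_⟩
    · rintro _ ⟨m, hm, rfl⟩
      exact (h m hm).2.1
    · rintro j ⟨m, hm, hj1, hj2⟩
      exact (h m hm).2.2 j hj1 hj2
  · rintro ⟨h, h'⟩ m hm
    exact ⟨hy m, h _ ⟨m, hm, rfl⟩, fun j hj1 hj2 => h' j ⟨m, hm, hj1, hj2⟩⟩

lemma measurable_greedy {Ω : Type*} [MeasurableSpace Ω] (K : ℕ) {S : Ω → Set ℕ}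
    (hS : ∀ j, MeasurableSet {ω | j ∈ S ω}) (m : ℕ) : Measurable fun ω => greedy K (S ω) m := by
  have hrec : ∀ a b, MeasurableSet {ω | sInf {s : ℕ | s ∈ S ω ∧ a ≤ s} = b} := by
    intro a b
    -- The second alternative covers the empty set, whose infimum is 0 by convention.
    have : {ω | sInf {s : ℕ | s ∈ S ω ∧ a ≤ s} = b} =
        {ω | ((b ∈ S ω ∧ a ≤ b) ∧ ∀ j < b, ¬ (j ∈ S ω ∧ a ≤ j)) ∨
          (b = 0 ∧ ∀ j, ¬ (j ∈ S ω ∧ a ≤ j))} := by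
      ext ω
      constructor
      · rintro rfl
        rcases Set.eq_empty_or_nonempty {s : ℕ | s ∈ S ω ∧ a ≤ s} with h | h
        · exact Or.inr ⟨by rw [h]; simp, fun j hj => by
            have : j ∈ {s : ℕ | s ∈ S ω ∧ a ≤ s} := hj
            simp [h] at this⟩
        · exact Or.inl ⟨Nat.sInf_mem h, fun j hj => Nat.notMem_of_lt_sInf hj⟩
      · rintro (⟨h1, h2⟩ | ⟨rfl, h⟩)
        · refine IsLeast.csInf_eq ⟨h1, fun s hs => ?_⟩
          by_contra hlt
          exact h2 s (not_le.mp hlt) hs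
        · have : {s : ℕ | s ∈ S ω ∧ a ≤ s} = ∅ := Set.eq_empty_of_forall_notMem h
          rw [Set.mem_ofPred_eq, this, Nat.sInf_empty]
    rw [this]
    have h1 : ∀ j, Measurable fun ω => j ∈ S ω ∧ a ≤ j := fun j =>
      (measurableSet_setOfPred.1 (hS j)).and measurable_const
    refine measurableSet_setOfPred.2 (((h1 b).and ?_).or (measurable_const.and ?_))
    · exact Measurable.forall fun j => measurable_const.imp (h1 j).not
    · exact Measurable.forall fun j => (h1 j).not
  induction m with
  | zero =>
    refine measurable_to_countable' fun b => ?_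
    have := hrec 0 b
    simp only [zero_le, and_true] at this
    exact this
  | succ m ih =>
    refine measurable_to_countable' fun b => ?_
    have : (fun ω => greedy K (S ω) (m + 1)) ⁻¹' {b} = ⋃ a, (fun ω => greedy K (S ω) m) ⁻¹' {a} ∩
        {ω | sInf {s : ℕ | s ∈ S ω ∧ a + K ≤ s} = b} := by
      ext ω
      simp [greedy]
    rw [this]
    exact MeasurableSet.iUnion fun a => (ih (measurableSet_singleton a)).inter (hrec (a + K) b)

/-! ### Void gaps after the greedy points of a Bernoulli set -/

section Bernoulli

variable {Ω : Type*} [MeasurableSpace Ω] {P : Measure Ω} {S : Ω → Set ℕ} {p q : ENNReal}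

/-- The event that `S` has no points in the gaps after its first `n` greedy points, below `L`. -/
def voidGaps (K L n : ℕ) (S : Ω → Set ℕ) : Set Ω :=
  {ω | ∀ j ∈ gapPositions K L n (greedy K (S ω)), j ∉ S ω}

lemma gapPositions_congr {K L n : ℕ} {y z : ℕ → ℕ} (h : ∀ m < n, y m = z m) :
    gapPositions K L n y = gapPositions K L n z := by
  refine Finset.biUnion_congr rfl fun m hm => ?_
  rw [h m (Finset.mem_range.1 hm)]

lemma measurableSet_voidGaps (K L n : ℕ) (hS : ∀ j, MeasurableSet {ω | j ∈ S ω}) :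
    MeasurableSet (voidGaps K L n S) := by
  have : voidGaps K L n S = {ω | ∀ j m, m < n → (greedy K (S ω) m + 1 ≤ j ∧
      j < min (greedy K (S ω) m + K) L) → j ∉ S ω} := by
    ext ω
    simp only [voidGaps, gapPositions, Set.mem_ofPred_eq, Finset.mem_biUnion, Finset.mem_range,
      Finset.mem_Ico]
    exact ⟨fun h j m hm hj => h j ⟨m, hm, hj⟩, fun h j ⟨m, hm, hj⟩ => h j m hm hj⟩
  rw [this]
  refine measurableSet_setOfPred.2 (Measurable.forall fun j => Measurable.forall fun m =>
    measurable_const.imp (Measurable.imp ?_ (measurableSet_setOfPred.1 (hS j)).not))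
  exact (measurable_of_countable fun a : ℕ => a + 1 ≤ j ∧ j < min (a + K) L).comp
    (measurable_greedy K hS m)

/-- Such a `g` factors through the countable space `Fin n → ℕ`, where every function is measurable.
-/
lemma measurable_comp_greedy {β : Type*} [MeasurableSpace β] (K n : ℕ)
    (hS : ∀ j, MeasurableSet {ω | j ∈ S ω}) (g : (ℕ → ℕ) → β)
    (hg : ∀ y z, (∀ m < n, y m = z m) → g y = g z) :
    Measurable fun ω => g (greedy K (S ω)) := by
  have hY : Measurable fun ω (m : Fin n) => greedy K (S ω) m :=
    measurable_pi_lambda _ fun m => measurable_greedy K hS m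
  have : (fun ω => g (greedy K (S ω))) =
      (fun y : Fin n → ℕ => g fun m => if h : m < n then y ⟨m, h⟩ else 0) ∘
        fun ω (m : Fin n) => greedy K (S ω) m := by
    ext ω
    exact hg _ _ fun m hm => by simp [hm]
  rw [this]
  exact (measurable_of_countable _).comp hY

/-- Both events are cylinder events. The first one adds only the requirement that the gap positions
be vacant; these are disjoint from the chosen and the skipped positions, so independence contributes
one factor `q` for each. -/
lemma measure_greedy_eq_inter_voidGaps {K : ℕ} (hK : 0 < K) (L n : ℕ)
    (hinf : ∀ᵐ ω ∂P, (S ω).Infinite)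
    (hprod : ∀ A B : Finset ℕ, Disjoint A B →
      P {ω | (∀ j ∈ A, j ∈ S ω) ∧ ∀ j ∈ B, j ∉ S ω} = p ^ A.card * q ^ B.card)
    {y : ℕ → ℕ} (hy : ∀ m, searchStart K y m ≤ y m) :
    P ({ω | ∀ m < n, greedy K (S ω) m = y m} ∩ voidGaps K L n S) =
      q ^ (gapPositions K L n y).card * P {ω | ∀ m < n, greedy K (S ω) m = y m} := by
  have h1 : P {ω | ∀ m < n, greedy K (S ω) m = y m} =
      P {ω | (∀ j ∈ (Finset.range n).image y, j ∈ S ω) ∧ ∀ j ∈ skippedPositions K n y, j ∉ S ω} := by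
    refine measure_congr ?_
    filter_upwards [hinf] with ω hω
    exact propext (greedy_eq_iff_image_skippedPositions K n hω hy)
  have h2 : P ({ω | ∀ m < n, greedy K (S ω) m = y m} ∩ voidGaps K L n S) =
      P {ω | (∀ j ∈ (Finset.range n).image y, j ∈ S ω) ∧
        ∀ j ∈ skippedPositions K n y ∪ gapPositions K L n y, j ∉ S ω} := by
    refine measure_congr ?_
    filter_upwards [hinf] with ω hω
    refine propext ?_
    have h3 := greedy_eq_iff_image_skippedPositions K n hω hy
    constructor
    · rintro ⟨ha, hb⟩
      refine ⟨(h3.1 ha).1, fun j hj => ?_⟩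
      rcases Finset.mem_union.1 hj with hj | hj
      · exact (h3.1 ha).2 j hj
      · exact hb j (by rwa [gapPositions_congr ha])
    · rintro ⟨ha, hb⟩
      have hc := h3.2 ⟨ha, fun j hj => hb j (Finset.mem_union_left _ hj)⟩
      refine ⟨hc, fun j hj => hb j (Finset.mem_union_right _ ?_)⟩
      rwa [gapPositions_congr hc] at hj
  rw [h1, h2, hprod _ _ (disjoint_image_skippedPositions hK n hy),
    hprod _ _ (Finset.disjoint_union_right.2 ⟨disjoint_image_skippedPositions hK n hy,
      disjoint_image_gapPositions L n hy⟩),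
    Finset.card_union_of_disjoint (disjoint_skippedPositions_gapPositions L n hy), pow_add]
  ring

/-- On a countable space it suffices to compare atoms. An atom that no infinite `S ω` attains is
null on both sides. -/
lemma map_restrict_voidGaps {K : ℕ} (hK : 0 < K) (L n : ℕ)
    (hS : ∀ j, MeasurableSet {ω | j ∈ S ω}) (hinf : ∀ᵐ ω ∂P, (S ω).Infinite)
    (hprod : ∀ A B : Finset ℕ, Disjoint A B →
      P {ω | (∀ j ∈ A, j ∈ S ω) ∧ ∀ j ∈ B, j ∉ S ω} = p ^ A.card * q ^ B.card) :
    (P.restrict (voidGaps K L n S)).map (fun ω (m : Fin n) => greedy K (S ω) m) =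
      (P.withDensity fun ω => q ^ (gapPositions K L n (greedy K (S ω))).card).map
        (fun ω (m : Fin n) => greedy K (S ω) m) := by
  have hY : Measurable fun ω (m : Fin n) => greedy K (S ω) m :=
    measurable_pi_lambda _ fun m => measurable_greedy K hS m
  refine Measure.ext_of_singleton fun y => ?_
  have hmeas := hY (measurableSet_singleton y)
  rw [Measure.map_apply hY (measurableSet_singleton y),
    Measure.map_apply hY (measurableSet_singleton y), Measure.restrict_apply hmeas,
    withDensity_apply _ hmeas]
  by_cases hex : ∃ ω, (S ω).Infinite ∧ (fun m : Fin n => greedy K (S ω) m) = y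
  · obtain ⟨ω₀, hω₀, rfl⟩ := hex
    have hset : (fun ω (m : Fin n) => greedy K (S ω) m) ⁻¹' {fun m : Fin n => greedy K (S ω₀) m} =
        {ω | ∀ m < n, greedy K (S ω) m = greedy K (S ω₀) m} := by
      ext ω
      simp only [Set.mem_preimage, Set.mem_singleton_iff, funext_iff, Set.mem_ofPred_eq]
      exact ⟨fun h m hm => h ⟨m, hm⟩, fun h m => h m m.2⟩
    rw [hset] at hmeas ⊢
    rw [measure_greedy_eq_inter_voidGaps hK L n hinf hprod fun m => (greedy_spec K hω₀ m).1,
      setLIntegral_congr_fun (g := fun _ => q ^ (gapPositions K L n (greedy K (S ω₀))).card) hmeas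
        (fun ω hω => by simp only [gapPositions_congr hω])]
    simp
  · have h0 : P ((fun ω (m : Fin n) => greedy K (S ω) m) ⁻¹' {y}) = 0 := by
      refine measure_mono_null (fun ω hω hi => hex ⟨ω, hi, hω⟩) (ae_iff.1 hinf)
    rw [measure_mono_null Set.inter_subset_left h0, Measure.restrict_eq_zero.2 h0,
      lintegral_zero_measure]

lemma integral_indicator_voidGaps_mul [IsProbabilityMeasure P] {K : ℕ} (hK : 0 < K) (L n : ℕ)
    (hS : ∀ j, MeasurableSet {ω | j ∈ S ω}) (hinf : ∀ᵐ ω ∂P, (S ω).Infinite) (hq : q ≠ ⊤)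
    (hprod : ∀ A B : Finset ℕ, Disjoint A B →
      P {ω | (∀ j ∈ A, j ∈ S ω) ∧ ∀ j ∈ B, j ∉ S ω} = p ^ A.card * q ^ B.card)
    (f : (Fin n → ℕ) → ℝ) :
    ∫ ω, (voidGaps K L n S).indicator (fun ω => f fun m => greedy K (S ω) m) ω ∂P =
      ∫ ω, q.toReal ^ (gapPositions K L n (greedy K (S ω))).card *
        f (fun m => greedy K (S ω) m) ∂P := by
  have hY : Measurable fun ω (m : Fin n) => greedy K (S ω) m :=
    measurable_pi_lambda _ fun m => measurable_greedy K hS m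
  have hcard : Measurable fun ω => q ^ (gapPositions K L n (greedy K (S ω))).card :=
    measurable_comp_greedy K n hS (fun y => q ^ (gapPositions K L n y).card)
      fun y z h => by rw [gapPositions_congr h]
  rw [integral_indicator (measurableSet_voidGaps K L n hS)]
  have := congrArg (fun μ : Measure (Fin n → ℕ) => ∫ y, f y ∂μ)
    (map_restrict_voidGaps hK L n hS hinf hprod)
  rw [integral_map hY.aemeasurable (measurable_of_countable f).aestronglyMeasurable,
    integral_map hY.aemeasurable (measurable_of_countable f).aestronglyMeasurable,
    integral_withDensity_eq_integral_toReal_smul hcard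
      (ae_of_all _ fun ω => ENNReal.pow_lt_top hq.lt_top)] at this
  simpa using this

end Bernoulli

/-! ### Void probabilities and discretization of a Poisson process -/

section Poisson

open Filter Topology

lemma pointCount_eq_zero_iff {Ω : Type*} {X : ℕ → Ω → ℝ} {B : Set ℝ} {ω : Ω} :
    pointCount X B ω = 0 ↔ ∀ i, X i ω ∉ B := by
  simp [pointCount, Set.eq_empty_iff_forall_notMem]

variable {Ω : Type*} [MeasurableSpace Ω] {P : Measure Ω} {rate : ℝ≥0} {X : ℕ → Ω → ℝ}

namespace IsHomogeneousPoissonProcess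

lemma measure_pointCount_eq_zero (hX : IsHomogeneousPoissonProcess P rate X) {B : Set ℝ}
    (hB : MeasurableSet B) (hB0 : B ⊆ Set.Ici 0) (hBfin : volume B ≠ ⊤) :
    P {ω | pointCount X B ω = 0} = ENNReal.ofReal (Real.exp (-(rate * (volume B).toReal))) := by
  have h := (hX.hasLaw_pointCount B hB hB0 hBfin).measure_eq (p := fun n => n = 0)
    (measurableSet_singleton (0 : ℕ∞))
  rw [h, Measure.map_apply .of_discrete .of_discrete]
  have : (fun n : ℕ => (n : ℕ∞)) ⁻¹' {x | x = 0} = {0} := by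
    ext n; simp
  rw [this, poissonMeasure_singleton]
  simp only [NNReal.coe_mul, pow_zero, mul_one, Nat.factorial_zero, Nat.cast_one, div_one]
  rfl

lemma ae_notMem_singleton [IsProbabilityMeasure P] (hX : IsHomogeneousPoissonProcess P rate X)
    {w : ℝ} (hw : 0 ≤ w) : ∀ᵐ ω ∂P, ∀ i, X i ω ≠ w := by
  have h := hX.measure_pointCount_eq_zero (measurableSet_singleton w) (by simpa using hw) (by simp)
  simp only [Real.volume_singleton, ENNReal.toReal_zero, mul_zero, neg_zero, Real.exp_zero,
    ENNReal.ofReal_one, pointCount_eq_zero_iff, Set.mem_singleton_iff] at h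
  refine (prob_compl_eq_zero_iff₀ ?_).2 h
  exact (MeasurableSet.nullMeasurableSet (measurableSet_setOfPred.2 (Measurable.forall fun i =>
    (measurableSet_setOfPred.1 (hX.measurable i (measurableSet_singleton w))).not)))

/-- A Poisson count is almost surely finite, whereas a monotone sequence that stays bounded would
put infinitely many indices in some `[0, M]`. -/
lemma ae_tendsto_atTop (hX : IsHomogeneousPoissonProcess P rate X)
    (hmono : ∀ ω, Monotone fun i => X i ω) :
    ∀ᵐ ω ∂P, Tendsto (fun i => X i ω) atTop atTop := by
  have h : ∀ M : ℕ, ∀ᵐ ω ∂P, pointCount X (Set.Icc 0 M) ω ≠ ⊤ := by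
    intro M
    have h := (hX.hasLaw_pointCount (Set.Icc 0 M) measurableSet_Icc Set.Icc_subset_Ici_self
      (by simp)).measure_eq (p := fun n => n = ⊤) (measurableSet_singleton (⊤ : ℕ∞))
    rw [Measure.map_apply .of_discrete .of_discrete] at h
    rw [ae_iff]
    simp only [ne_eq, not_not]
    rw [h]
    convert measure_empty (μ := poissonMeasure _)
    ext n; simp
  filter_upwards [ae_all_iff.2 h] with ω hω
  refine tendsto_atTop_atTop_of_monotone (hmono ω) fun b => ?_
  obtain ⟨M, hM⟩ := exists_nat_ge b
  by_contra! hlt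
  refine hω M ?_
  have : {i : ℕ | X i ω ∈ Set.Icc (0 : ℝ) M} = Set.univ :=
    Set.eq_univ_of_forall fun i => ⟨hX.nonneg i ω, ((hlt i).trans_le hM).le⟩
  rw [pointCount, this]
  simp

end IsHomogeneousPoissonProcess

/-- The indices `j` of the cells `[j / K, (j + 1) / K)` that contain a point of `X`. -/
def occupiedCells (X : ℕ → Ω → ℝ) (K : ℕ) (ω : Ω) : Set ℕ :=
  Set.range fun i => ⌊(K : ℝ) * X i ω⌋₊

/-- The `j`-th cell of the grid with mesh `1 / K`. -/
def gridCell (K j : ℕ) : Set ℝ := Set.Ico ((j : ℝ) / K) ((j + 1 : ℝ) / K)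

lemma measurableSet_gridCell (K j : ℕ) : MeasurableSet (gridCell K j) := measurableSet_Ico

lemma volume_gridCell (K j : ℕ) : volume (gridCell K j) = ENNReal.ofReal (1 / K) := by
  rw [gridCell, Real.volume_Ico]
  congr 1
  ring

lemma pairwise_disjoint_gridCell (K : ℕ) :
    Pairwise fun i j => Disjoint (gridCell K i) (gridCell K j) := by
  rcases Nat.eq_zero_or_pos K with rfl | hK
  · intro i j _
    simp [gridCell]
  have hK' : (0 : ℝ) < K := by exact_mod_cast hK
  intro i j hij
  refine Set.disjoint_left.2 fun x hi hj => hij ?_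
  simp only [gridCell, Set.mem_Ico, div_le_iff₀ hK', lt_div_iff₀ hK'] at hi hj
  have h1 : i < j + 1 := by exact_mod_cast hi.1.trans_lt hj.2
  have h2 : j < i + 1 := by exact_mod_cast hj.1.trans_lt hi.2
  omega

lemma gridCell_subset_Ici (K j : ℕ) : gridCell K j ⊆ Set.Ici 0 := fun x hx =>
  (show (0 : ℝ) ≤ (j : ℝ) / K by positivity).trans hx.1

lemma mem_occupiedCells_iff {Ω : Type*} {X : ℕ → Ω → ℝ} (hnonneg : ∀ i ω, 0 ≤ X i ω)
    {K : ℕ} (hK : 0 < K) (j : ℕ) (ω : Ω) :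
    j ∈ occupiedCells X K ω ↔ pointCount X (gridCell K j) ω ≠ 0 := by
  have hK' : (0 : ℝ) < K := by exact_mod_cast hK
  rw [ne_eq, pointCount_eq_zero_iff]
  push Not
  refine exists_congr fun i => ?_
  rw [Nat.floor_eq_iff (mul_nonneg hK'.le (hnonneg i ω)), gridCell, Set.mem_Ico, div_le_iff₀ hK',
    lt_div_iff₀ hK', mul_comm]

lemma measurableSet_mem_occupiedCells (hmeas : ∀ i, Measurable (X i)) (K j : ℕ) :
    MeasurableSet {ω | j ∈ occupiedCells X K ω} := by
  have : {ω | j ∈ occupiedCells X K ω} = ⋃ i, (fun ω => ⌊(K : ℝ) * X i ω⌋₊) ⁻¹' {j} := by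
    ext ω
    simp [occupiedCells]
  rw [this]
  exact MeasurableSet.iUnion fun i =>
    Nat.measurable_floor.comp ((hmeas i).const_mul _) (measurableSet_singleton j)

lemma infinite_occupiedCells {Ω : Type*} {X : ℕ → Ω → ℝ} {ω : Ω}
    (h : Tendsto (fun i => X i ω) atTop atTop) {K : ℕ} (hK : 0 < K) : (occupiedCells X K ω).Infinite := by
  have hK' : (0 : ℝ) < K := by exact_mod_cast hK
  have h1 : Tendsto (fun i => ⌊(K : ℝ) * X i ω⌋₊) atTop atTop :=
    tendsto_nat_floor_atTop.comp (h.const_mul_atTop hK')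
  refine Set.infinite_of_forall_exists_gt fun a => ?_
  obtain ⟨i, hi⟩ := (h1.eventually_gt_atTop a).exists
  exact ⟨_, ⟨i, rfl⟩, hi⟩

namespace IsHomogeneousPoissonProcess

/-- Distinct cells of the grid are occupied independently, with the same probability. -/
lemma measure_occupiedCells [IsProbabilityMeasure P] (hX : IsHomogeneousPoissonProcess P rate X)
    {K : ℕ} (hK : 0 < K) (A B : Finset ℕ) (hAB : Disjoint A B) :
    P {ω | (∀ j ∈ A, j ∈ occupiedCells X K ω) ∧ ∀ j ∈ B, j ∉ occupiedCells X K ω} =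
      (1 - ENNReal.ofReal (Real.exp (-(rate / K)))) ^ A.card *
        ENNReal.ofReal (Real.exp (-(rate / K))) ^ B.card := by
  classical
  -- Independence is available for families indexed by `Fin N`, so `A ∪ B` is embedded in an initial
  -- segment.
  obtain ⟨N, hN⟩ := (A ∪ B).exists_nat_subset_range
  have hind := hX.iIndepFun_pointCount N (fun j => gridCell K j) (fun j => measurableSet_gridCell K j)
    (fun j => gridCell_subset_Ici K j)
    (fun i j hij => pairwise_disjoint_gridCell K (by simpa [Fin.ext_iff] using hij))
  have hzero : ∀ j, P {ω | pointCount X (gridCell K j) ω = 0} =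
      ENNReal.ofReal (Real.exp (-(rate / K))) := by
    intro j
    rw [hX.measure_pointCount_eq_zero (measurableSet_gridCell K j) (gridCell_subset_Ici K j)
      (by rw [volume_gridCell]; simp), volume_gridCell, ENNReal.toReal_ofReal (by positivity),
      mul_one_div]
  have hmem := fun j ω => mem_occupiedCells_iff (X := X) hX.nonneg hK j ω
  have hne : ∀ j, P {ω | pointCount X (gridCell K j) ω ≠ 0} =
      1 - ENNReal.ofReal (Real.exp (-(rate / K))) := by
    intro j
    have hm : MeasurableSet {ω | pointCount X (gridCell K j) ω = 0} := by
      have := (measurableSet_mem_occupiedCells hX.measurable K j).compl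
      convert this using 1
      ext ω
      simp [hmem]
    rw [← hzero j, ← prob_compl_eq_one_sub hm]
    rfl
  have key := hind.measure_inter_preimage_eq_mul
    (Finset.univ.filter fun j : Fin N => (j : ℕ) ∈ A ∪ B)
    (sets := fun j => if (j : ℕ) ∈ A then {0}ᶜ else {0}) (fun _ _ => MeasurableSet.of_discrete)
  have hset : {ω | (∀ j ∈ A, j ∈ occupiedCells X K ω) ∧ ∀ j ∈ B, j ∉ occupiedCells X K ω} =
      ⋂ j ∈ Finset.univ.filter fun j : Fin N => (j : ℕ) ∈ A ∪ B,
        (fun ω => pointCount X (gridCell K j) ω) ⁻¹' (if (j : ℕ) ∈ A then {0}ᶜ else {0}) := by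
    ext ω
    simp only [Set.mem_iInter, Set.mem_preimage, Finset.mem_filter, Finset.mem_univ, true_and,
      hmem, Set.mem_ofPred_eq]
    constructor
    · rintro ⟨h1, h2⟩ j hj
      by_cases hjA : (j : ℕ) ∈ A
      · simpa [hjA] using h1 j hjA
      · simpa [hjA] using h2 j ((Finset.mem_union.1 hj).resolve_left hjA)
    · intro h
      refine ⟨fun j hj => ?_, fun j hj => ?_⟩
      · have hj' := Finset.mem_union_left B hj
        simpa [hj] using h ⟨j, Finset.mem_range.1 (hN hj')⟩ hj'
      · have hj' := Finset.mem_union_right A hj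
        simpa [Finset.disjoint_right.1 hAB hj] using h ⟨j, Finset.mem_range.1 (hN hj')⟩ hj'
  have hfac : ∀ j : ℕ, P (pointCount X (gridCell K j) ⁻¹'
      (if j ∈ A then {0}ᶜ else {0})) =
      if j ∈ A then 1 - ENNReal.ofReal (Real.exp (-(rate / K)))
        else ENNReal.ofReal (Real.exp (-(rate / K))) := by
    intro j
    split_ifs with h
    · exact hne j
    · exact hzero j
  rw [hset, key, Finset.prod_congr rfl fun (j : Fin N) _ => hfac j]
  have himage : (Finset.univ.filter fun j : Fin N => (j : ℕ) ∈ A ∪ B).map Fin.valEmbedding =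
      A ∪ B := by
    ext j
    simp only [Finset.mem_map, Finset.mem_filter, Finset.mem_univ, true_and, Fin.valEmbedding_apply]
    exact ⟨by rintro ⟨i, hi, rfl⟩; exact hi, fun h => ⟨⟨j, Finset.mem_range.1 (hN h)⟩, h, rfl⟩⟩
  have := Finset.prod_map (Finset.univ.filter fun j : Fin N => (j : ℕ) ∈ A ∪ B) Fin.valEmbedding
    fun j : ℕ => if j ∈ A then 1 - ENNReal.ofReal (Real.exp (-(rate / K)))
        else ENNReal.ofReal (Real.exp (-(rate / K)))
  rw [himage] at this
  refine this.symm.trans ?_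
  rw [Finset.prod_union hAB, Finset.prod_congr rfl fun j hj => if_pos hj,
    Finset.prod_congr rfl fun j hj => if_neg (Finset.disjoint_right.1 hAB hj)]
  simp

/-- Almost surely no two points are at distance exactly `1`. -/
lemma ae_ne_add_one [IsProbabilityMeasure P] (hX : IsHomogeneousPoissonProcess P rate X) :
    ∀ᵐ ω ∂P, ∀ i j, X j ω ≠ X i ω + 1 := by
  have hbound : ∀ M : ℕ, P {ω | ∃ i j, X j ω = X i ω + 1 ∧ X i ω < M} = 0 := by
    intro M
    have hle : ∀ K : ℕ, 0 < K → P {ω | ∃ i j, X j ω = X i ω + 1 ∧ X i ω < M} ≤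
        ENNReal.ofReal (M * rate ^ 2 / K) := by
      intro K hK
      have hK' : (0 : ℝ) < K := by exact_mod_cast hK
      -- Points at distance exactly 1 occupy cells `a` and `a + K`. There are `M * K` choices of
      -- `a`, each of probability at most `(rate / K) ^ 2`, so the union bound vanishes as `K → ∞`.
      have hsub : {ω | ∃ i j, X j ω = X i ω + 1 ∧ X i ω < M} ⊆
          ⋃ a ∈ Finset.range (M * K),
            {ω | (∀ j ∈ ({a, a + K} : Finset ℕ), j ∈ occupiedCells X K ω) ∧
              ∀ j ∈ (∅ : Finset ℕ), j ∉ occupiedCells X K ω} := by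
        rintro ω ⟨i, j, hij, hi⟩
        simp only [Set.mem_iUnion, Finset.mem_range]
        refine ⟨⌊(K : ℝ) * X i ω⌋₊, ?_, ?_, by simp⟩
        · rw [Nat.floor_lt (mul_nonneg hK'.le (hX.nonneg i ω))]
          push_cast
          rw [mul_comm]
          exact mul_lt_mul_of_pos_right hi hK'
        · intro b hb
          simp only [Finset.mem_insert, Finset.mem_singleton] at hb
          rcases hb with rfl | rfl
          · exact ⟨i, rfl⟩
          · refine ⟨j, ?_⟩
            simp only [hij]
            rw [mul_add, mul_one, Nat.floor_add_natCast (mul_nonneg hK'.le (hX.nonneg i ω))]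
      have hexp : 1 - ENNReal.ofReal (Real.exp (-(rate / K))) ≤ ENNReal.ofReal (rate / K) := by
        rw [← ENNReal.ofReal_one, ← ENNReal.ofReal_sub _ (Real.exp_pos _).le]
        refine ENNReal.ofReal_le_ofReal ?_
        have := Real.add_one_le_exp (-((rate : ℝ) / K))
        linarith
      refine (measure_mono hsub).trans ((measure_biUnion_finset_le _ _).trans ?_)
      have hterm : ∀ a ∈ Finset.range (M * K),
          P {ω | (∀ j ∈ ({a, a + K} : Finset ℕ), j ∈ occupiedCells X K ω) ∧
              ∀ j ∈ (∅ : Finset ℕ), j ∉ occupiedCells X K ω} ≤ ENNReal.ofReal ((rate / K) ^ 2) := by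
        intro a _
        rw [hX.measure_occupiedCells hK _ _ (Finset.disjoint_empty_right _),
          Finset.card_pair (by omega), Finset.card_empty, pow_zero, mul_one,
          ENNReal.ofReal_pow (by positivity)]
        gcongr
      refine (Finset.sum_le_sum hterm).trans ?_
      rw [Finset.sum_const, Finset.card_range, nsmul_eq_mul, ← ENNReal.ofReal_natCast,
        ← ENNReal.ofReal_mul (by positivity)]
      refine ENNReal.ofReal_le_ofReal (le_of_eq ?_)
      push_cast
      field_simp
    have hlim : Tendsto (fun K : ℕ => ENNReal.ofReal (M * rate ^ 2 / K)) atTop (𝓝 0) := by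
      rw [← ENNReal.ofReal_zero]
      exact ENNReal.tendsto_ofReal (tendsto_const_div_atTop_nhds_zero_nat _)
    refine le_antisymm (ge_of_tendsto hlim ?_) zero_le
    filter_upwards [eventually_gt_atTop 0] with K hK using hle K hK
  have hall : ∀ᵐ ω ∂P, ∀ M : ℕ, ¬ ∃ i j, X j ω = X i ω + 1 ∧ X i ω < M := by
    refine ae_all_iff.2 fun M => ?_
    rw [ae_iff]
    simpa only [not_not] using hbound M
  filter_upwards [hall] with ω hω i j hij
  obtain ⟨M, hM⟩ := exists_nat_gt (X i ω)
  exact hω M ⟨i, j, hij, hM⟩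

end IsHomogeneousPoissonProcess

end Poisson

/-! ### The points `X_m*` as limits of greedy points -/

section Star

open Filter Topology

variable {Ω : Type*} {X : ℕ → Ω → ℝ} {ω : Ω}

/-- Divergence supplies a first index past the threshold, and monotonicity makes its point the least
one, so the infimum is attained. -/
lemma starPoint_succ_spec (hmono : Monotone fun i => X i ω)
    (hlim : Tendsto (fun i => X i ω) atTop atTop) (m : ℕ) :
    ∃ i, starPoint X (m + 1) ω = X i ω ∧ starPoint X m ω + 1 ≤ X i ω ∧
      ∀ k < i, X k ω < starPoint X m ω + 1 := by
  classical
  have hex : ∃ i, starPoint X m ω + 1 ≤ X i ω := (hlim.eventually_ge_atTop _).exists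
  have hlt : ∀ k < Nat.find hex, X k ω < starPoint X m ω + 1 := fun k hk =>
    not_le.1 (Nat.find_min hex hk)
  refine ⟨Nat.find hex, ?_, Nat.find_spec hex, hlt⟩
  refine IsLeast.csInf_eq ⟨⟨⟨_, rfl⟩, Nat.find_spec hex⟩, ?_⟩
  rintro _ ⟨⟨k, rfl⟩, hk⟩
  exact hmono (le_of_not_gt fun h => absurd (hlt k h) (not_lt.2 hk))

lemma exists_starPoint_eq (hmono : Monotone fun i => X i ω)
    (hlim : Tendsto (fun i => X i ω) atTop atTop) (m : ℕ) : ∃ i, starPoint X m ω = X i ω := by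
  cases m with
  | zero => exact ⟨0, rfl⟩
  | succ m =>
    obtain ⟨i, hi, -⟩ := starPoint_succ_spec hmono hlim m
    exact ⟨i, hi⟩

lemma starPoint_add_one_le (hmono : Monotone fun i => X i ω)
    (hlim : Tendsto (fun i => X i ω) atTop atTop) (m : ℕ) :
    starPoint X m ω + 1 ≤ starPoint X (m + 1) ω := by
  obtain ⟨i, hi, h, -⟩ := starPoint_succ_spec hmono hlim m
  rwa [hi]

lemma strictMono_starPoint (hmono : Monotone fun i => X i ω)
    (hlim : Tendsto (fun i => X i ω) atTop atTop) : StrictMono fun m => starPoint X m ω :=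
  strictMono_nat_of_lt_succ fun m => by
    have := starPoint_add_one_le hmono hlim m
    linarith

lemma starPoint_succ_le (hmono : Monotone fun i => X i ω)
    (hlim : Tendsto (fun i => X i ω) atTop atTop) {m i : ℕ}
    (h : starPoint X m ω + 1 ≤ X i ω) : starPoint X (m + 1) ω ≤ X i ω := by
  obtain ⟨k, hk, -, hlt⟩ := starPoint_succ_spec hmono hlim m
  rw [hk]
  exact hmono (le_of_not_gt fun hik => absurd (hlt i hik) (not_lt.2 h))

/-- This is why any `n > w` is enough: the points of index at least `n` lie beyond `w`. -/
lemma natCast_le_starPoint (hnonneg : ∀ i ω, 0 ≤ X i ω) (hmono : Monotone fun i => X i ω)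
    (hlim : Tendsto (fun i => X i ω) atTop atTop) (m : ℕ) : (m : ℝ) ≤ starPoint X m ω := by
  induction m with
  | zero => simpa [starPoint] using hnonneg 0 ω
  | succ m ih =>
    have := starPoint_add_one_le hmono hlim m
    push_cast
    linarith

lemma eventually_floor_natCast_mul_lt {a b : ℝ} (ha : 0 ≤ a) (hab : a < b) :
    ∀ᶠ K : ℕ in atTop, ⌊(K : ℝ) * a⌋₊ < ⌊(K : ℝ) * b⌋₊ := by
  have h := tendsto_natCast_atTop_atTop.atTop_mul_const (sub_pos.2 hab)
  filter_upwards [h.eventually_ge_atTop 1] with K hK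
  rw [Nat.lt_iff_add_one_le, ← Nat.floor_add_one (by positivity)]
  exact Nat.floor_mono (by linarith)

/-- Only finitely many points precede the next star point, all strictly left of the threshold
`starPoint X m ω + 1`. A fine grid separates their cells from that of the threshold, which lies
exactly `K` cells after the cell of the current star point. -/
lemma eventually_greedy_occupiedCells_eq (hnonneg : ∀ i ω, 0 ≤ X i ω)
    (hmono : Monotone fun i => X i ω) (hlim : Tendsto (fun i => X i ω) atTop atTop) (m : ℕ) :
    ∀ᶠ K : ℕ in atTop, greedy K (occupiedCells X K ω) m = ⌊(K : ℝ) * starPoint X m ω⌋₊ := by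
  have hfloor : ∀ K : ℕ, Monotone fun i => ⌊(K : ℝ) * X i ω⌋₊ := fun K i j hij =>
    Nat.floor_mono (mul_le_mul_of_nonneg_left (hmono hij) K.cast_nonneg)
  induction m with
  | zero =>
    refine Eventually.of_forall fun K => IsLeast.csInf_eq ⟨⟨0, rfl⟩, ?_⟩
    rintro _ ⟨i, rfl⟩
    exact hfloor K (Nat.zero_le i)
  | succ m ih =>
    obtain ⟨i, hi, hle, hlt⟩ := starPoint_succ_spec hmono hlim m
    have hpos : 0 ≤ starPoint X m ω := m.cast_nonneg.trans (natCast_le_starPoint hnonneg hmono hlim m)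
    have hev : ∀ᶠ K : ℕ in atTop, ∀ k ∈ Finset.range i,
        ⌊(K : ℝ) * X k ω⌋₊ < ⌊(K : ℝ) * (starPoint X m ω + 1)⌋₊ :=
      (Filter.eventually_all_finset _).2 fun k hk =>
        eventually_floor_natCast_mul_lt (hnonneg k ω) (hlt k (Finset.mem_range.1 hk))
    filter_upwards [ih, hev] with K hK hKlt
    have hadd : ⌊(K : ℝ) * (starPoint X m ω + 1)⌋₊ = ⌊(K : ℝ) * starPoint X m ω⌋₊ + K := by
      rw [mul_add, mul_one, Nat.floor_add_natCast (by positivity)]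
    rw [hi, greedy, hK, ← hadd]
    refine IsLeast.csInf_eq ⟨⟨⟨i, rfl⟩, Nat.floor_mono (by gcongr)⟩, ?_⟩
    rintro _ ⟨⟨k, rfl⟩, hk⟩
    refine hfloor K (le_of_not_gt fun hki => ?_)
    exact absurd (hKlt k (Finset.mem_range.2 hki)) (not_lt.2 hk)

lemma mem_atMostEdges_zero_iff (hnonneg : ∀ i ω, 0 ≤ X i ω) (w : ℝ) :
    ω ∈ atMostEdges X w 0 ↔
      ∀ i j, X i ω < X j ω → X j ω ≤ w → X i ω + 1 < X j ω := by
  have h0 : ω ∈ atMostEdges X w 0 ↔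
      gilbertGraph (Set.range (fun i => X i ω) ∩ Set.Icc 0 w) = ⊥ := by
    simp [atMostEdges]
  rw [h0, SimpleGraph.eq_bot_iff_forall_not_adj]
  constructor
  · intro h i j hij hj
    by_contra! hle
    refine h ⟨X i ω, ⟨i, rfl⟩, hnonneg i ω, hij.le.trans hj⟩ ⟨X j ω, ⟨j, rfl⟩, hnonneg j ω, hj⟩
      ⟨fun he => hij.ne (congrArg Subtype.val he), ?_⟩
    rw [Real.dist_eq, abs_le]
    constructor <;> linarith
  · rintro h ⟨_, ⟨i, rfl⟩, hi0, hi⟩ ⟨_, ⟨j, rfl⟩, hj0, hj⟩ ⟨hne, hd⟩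
    replace hd : dist (X i ω) (X j ω) ≤ 1 := hd
    simp only [Real.dist_eq, abs_le] at hd
    rcases lt_or_gt_of_ne (fun he => hne (Subtype.ext he) : X i ω ≠ X j ω) with hlt | hlt
    · have := h i j hlt hj
      linarith
    · have := h j i hlt hi
      linarith

lemma measurableSet_atMostEdges_zero [MeasurableSpace Ω] (hmeas : ∀ i, Measurable (X i))
    (hnonneg : ∀ i ω, 0 ≤ X i ω) (w : ℝ) : MeasurableSet (atMostEdges X w 0) := by
  have : atMostEdges X w 0 =
      {ω | ∀ i j, X i ω < X j ω → X j ω ≤ w → X i ω + 1 < X j ω} := by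
    ext ω
    exact mem_atMostEdges_zero_iff hnonneg w
  rw [this]
  refine measurableSet_setOfPred.2 (Measurable.forall fun i => Measurable.forall fun j => ?_)
  refine Measurable.imp (measurableSet_setOfPred.1 (measurableSet_lt (hmeas i) (hmeas j))) ?_
  refine Measurable.imp (measurableSet_setOfPred.1 (measurableSet_le (hmeas j) measurable_const)) ?_
  exact measurableSet_setOfPred.1 (measurableSet_lt ((hmeas i).add_const 1) (hmeas j))

lemma measurable_starPoint [MeasurableSpace Ω] (hmeas : ∀ i, Measurable (X i)) (m : ℕ) :
    Measurable (starPoint X m) := by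
  induction m with
  | zero => exact hmeas 0
  | succ m ih =>
    refine measurable_of_Iio fun c => ?_
    have : starPoint X (m + 1) ⁻¹' Set.Iio c =
        {ω | (∃ i, starPoint X m ω + 1 ≤ X i ω ∧ X i ω < c) ∨
          ((∀ i, ¬ starPoint X m ω + 1 ≤ X i ω) ∧ 0 < c)} := by
      ext ω
      simp only [Set.mem_preimage, Set.mem_Iio, Set.mem_ofPred_eq, starPoint]
      by_cases hex : ∃ i, starPoint X m ω + 1 ≤ X i ω
      · have hne : {x : ℝ | x ∈ Set.range (fun i => X i ω) ∧ starPoint X m ω + 1 ≤ x}.Nonempty := by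
          obtain ⟨i, hi⟩ := hex
          exact ⟨X i ω, ⟨i, rfl⟩, hi⟩
        have hbdd : BddBelow {x : ℝ | x ∈ Set.range (fun i => X i ω) ∧ starPoint X m ω + 1 ≤ x} :=
          ⟨starPoint X m ω + 1, fun x hx => hx.2⟩
        rw [csInf_lt_iff hbdd hne]
        constructor
        · rintro ⟨_, ⟨⟨i, rfl⟩, hi⟩, hc⟩
          exact Or.inl ⟨i, hi, hc⟩
        · rintro (⟨i, hi, hc⟩ | ⟨h, -⟩)
          · exact ⟨X i ω, ⟨⟨i, rfl⟩, hi⟩, hc⟩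
          · exact absurd hex (not_exists.2 h)
      · have hempty : {x : ℝ | x ∈ Set.range (fun i => X i ω) ∧ starPoint X m ω + 1 ≤ x} = ∅ := by
          refine Set.eq_empty_of_forall_notMem ?_
          rintro _ ⟨⟨i, rfl⟩, hi⟩
          exact hex ⟨i, hi⟩
        rw [hempty, Real.sInf_empty]
        push Not at hex
        simp only [not_le, hex, implies_true, true_and]
        refine ⟨Or.inr, fun h => h.resolve_left ?_⟩
        rintro ⟨i, hi, -⟩
        exact absurd (hex i) (not_lt.2 hi)
    rw [this]
    have h1 : ∀ i, Measurable fun ω => starPoint X m ω + 1 ≤ X i ω := fun i =>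
      measurableSet_setOfPred.1 (measurableSet_le (ih.add_const 1) (hmeas i))
    refine measurableSet_setOfPred.2 (Measurable.or (Measurable.exists fun i => (h1 i).and ?_)
      (Measurable.and (Measurable.forall fun i => (h1 i).not) measurable_const))
    exact measurableSet_setOfPred.1 (measurableSet_lt (hmeas i) measurable_const)

lemma exists_starPoint_le_lt (hnonneg : ∀ i ω, 0 ≤ X i ω) (hmono : Monotone fun i => X i ω)
    (hlim : Tendsto (fun i => X i ω) atTop atTop) {x : ℝ} (hx : X 0 ω ≤ x) :
    ∃ m, starPoint X m ω ≤ x ∧ x < starPoint X (m + 1) ω := by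
  classical
  have hex : ∃ m, x < starPoint X m ω := by
    obtain ⟨m, hm⟩ := exists_nat_gt x
    exact ⟨m, hm.trans_le (natCast_le_starPoint hnonneg hmono hlim m)⟩
  have h0 : Nat.find hex ≠ 0 := fun h => by
    have := Nat.find_spec hex
    rw [h] at this
    exact absurd hx (not_le.2 this)
  obtain ⟨m, hm⟩ := Nat.exists_eq_succ_of_ne_zero h0
  refine ⟨m, not_lt.1 (Nat.find_min hex (by omega)), ?_⟩
  have := Nat.find_spec hex
  rwa [hm] at this

/-- An occupied gap cell yields a point joined to a star point. Conversely, an edge yields a point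
in some gap; excluding points at `w` and distances equal to 1 puts it strictly inside, where a fine
grid detects it. -/
lemma eventually_mem_voidGaps_iff (hnonneg : ∀ i ω, 0 ≤ X i ω) (hmono : Monotone fun i => X i ω)
    (hlim : Tendsto (fun i => X i ω) atTop atTop) {w : ℝ} (hw : ∀ i, X i ω ≠ w)
    (hone : ∀ i j, X j ω ≠ X i ω + 1) {n : ℕ} (hn : w < n) :
    ∀ᶠ K : ℕ in atTop, ω ∈ voidGaps K ⌊(K : ℝ) * w⌋₊ n (occupiedCells X K) ↔
      ω ∈ atMostEdges X w 0 := by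
  have hstar : ∀ᶠ K : ℕ in atTop, ∀ m ∈ Finset.range n,
      greedy K (occupiedCells X K ω) m = ⌊(K : ℝ) * starPoint X m ω⌋₊ :=
    (Filter.eventually_all_finset _).2 fun m _ =>
      eventually_greedy_occupiedCells_eq hnonneg hmono hlim m
  have hpos : ∀ m, 0 ≤ starPoint X m ω := fun m =>
    m.cast_nonneg.trans (natCast_le_starPoint hnonneg hmono hlim m)
  have hadd : ∀ (K m : ℕ), ⌊(K : ℝ) * (starPoint X m ω + 1)⌋₊ =
      ⌊(K : ℝ) * starPoint X m ω⌋₊ + K := fun K m => by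
    rw [mul_add, mul_one, Nat.floor_add_natCast (mul_nonneg K.cast_nonneg (hpos m))]
  have hlt : ∀ {K : ℕ} {a b : ℝ}, ⌊(K : ℝ) * a⌋₊ < ⌊(K : ℝ) * b⌋₊ → a < b := fun {K a b} h =>
    lt_of_mul_lt_mul_left (Nat.floor_mono.reflect_lt h) K.cast_nonneg
  by_cases hE : ω ∈ atMostEdges X w 0
  · filter_upwards [hstar] with K hK
    simp only [hE, iff_true]
    rintro j hj ⟨i, rfl⟩
    simp only [gapPositions, Finset.mem_biUnion, Finset.mem_Ico, lt_min_iff] at hj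
    obtain ⟨m, hm, h1, h2, h3⟩ := hj
    rw [hK m hm] at h1 h2
    rw [← hadd] at h2
    obtain ⟨k, hk⟩ := exists_starPoint_eq hmono hlim m
    have h4 := (mem_atMostEdges_zero_iff hnonneg w).1 hE k i (hk ▸ hlt h1) (hlt h3).le
    have h5 := hlt h2
    rw [hk] at h5
    linarith
  · rw [mem_atMostEdges_zero_iff hnonneg] at hE
    push Not at hE
    obtain ⟨i, j, hij, hjw, hj⟩ := hE
    have hjw' := lt_of_le_of_ne hjw (hw j)
    have hj' := lt_of_le_of_ne hj (hone i j)
    obtain ⟨m, hm1, hm2⟩ := exists_starPoint_le_lt hnonneg hmono hlim (hmono (Nat.zero_le i))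
    have hmn : m < n := by
      have := natCast_le_starPoint hnonneg hmono hlim m
      exact_mod_cast (show (m : ℝ) < n by linarith)
    -- If the left end of the edge is a star point, its right end lies in the gap. Otherwise the
    -- left end does, since a point at or beyond `starPoint X m ω + 1` would be at or past the next
    -- star point.
    obtain ⟨p, hp1, hp2, hp3⟩ : ∃ p, starPoint X m ω < X p ω ∧ X p ω < starPoint X m ω + 1 ∧
        X p ω < w := by
      rcases hm1.eq_or_lt with h | h
      · exact ⟨j, h ▸ hij, h ▸ hj', hjw'⟩
      · refine ⟨i, h, ?_, hij.trans hjw'⟩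
        by_contra! hge
        exact absurd (starPoint_succ_le hmono hlim hge) (not_le.2 hm2)
    filter_upwards [hstar, eventually_floor_natCast_mul_lt (hpos m) hp1,
      eventually_floor_natCast_mul_lt (hnonneg p ω) hp2,
      eventually_floor_natCast_mul_lt (hnonneg p ω) hp3] with K hK h1 h2 h3
    have hE' : ω ∉ atMostEdges X w 0 := fun h =>
      absurd ((mem_atMostEdges_zero_iff hnonneg w).1 h i j hij hjw) (not_lt.2 hj)
    simp only [hE', iff_false]
    intro hv
    refine hv ⌊(K : ℝ) * X p ω⌋₊ ?_ ⟨p, rfl⟩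
    simp only [gapPositions, Finset.mem_biUnion, Finset.mem_Ico, lt_min_iff]
    refine ⟨m, Finset.mem_range.2 hmn, ?_⟩
    rw [hK m (Finset.mem_range.2 hmn), ← hadd]
    exact ⟨h1, h2, h3⟩

/-- The total length of the gaps `[x m, x m + 1] ∩ [x m, w]`, `m < n`. -/
noncomputable def gapLength (w : ℝ) (n : ℕ) (x : ℕ → ℝ) : ℝ :=
  ∑ m ∈ Finset.range n, max (min (x m + 1) w - x m) 0

lemma gapLength_nonneg (w : ℝ) (n : ℕ) (x : ℕ → ℝ) : 0 ≤ gapLength w n x :=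
  Finset.sum_nonneg fun _ _ => le_max_right _ _

lemma tendsto_card_gapPositions_div (hnonneg : ∀ i ω, 0 ≤ X i ω) (hmono : Monotone fun i => X i ω)
    (hlim : Tendsto (fun i => X i ω) atTop atTop) {w : ℝ} (hw : 0 ≤ w) (n : ℕ) :
    Tendsto (fun K : ℕ => ((gapPositions K ⌊(K : ℝ) * w⌋₊ n
      (greedy K (occupiedCells X K ω))).card : ℝ) / K) atTop
      (𝓝 (gapLength w n fun m => starPoint X m ω)) := by
  have hfloor : ∀ a : ℝ, 0 ≤ a → Tendsto (fun K : ℕ => (⌊(K : ℝ) * a⌋₊ : ℝ) / K) atTop (𝓝 a) :=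
    fun a ha => by
      simpa only [mul_comm, Function.comp_def] using
        (tendsto_nat_floor_mul_div_atTop ha).comp tendsto_natCast_atTop_atTop
  have hpos : ∀ m, 0 ≤ starPoint X m ω := fun m =>
    m.cast_nonneg.trans (natCast_le_starPoint hnonneg hmono hlim m)
  -- The extra `1 / K` accounts for the cell of the greedy point itself, which its gap omits.
  have hsum : Tendsto (fun K : ℕ => ∑ m ∈ Finset.range n,
      max (min ((⌊(K : ℝ) * starPoint X m ω⌋₊ : ℝ) / K + 1) ((⌊(K : ℝ) * w⌋₊ : ℝ) / K) -
        ((⌊(K : ℝ) * starPoint X m ω⌋₊ : ℝ) / K + 1 / K)) 0) atTop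
      (𝓝 (gapLength w n fun m => starPoint X m ω)) := by
    refine tendsto_finsetSum _ fun m _ => ?_
    have h := (((hfloor _ (hpos m)).add_const 1).min (hfloor w hw)).sub
      ((hfloor _ (hpos m)).add tendsto_one_div_atTop_nhds_zero_nat)
    rw [add_zero] at h
    exact h.max tendsto_const_nhds
  refine hsum.congr' ?_
  have hstar : ∀ᶠ K : ℕ in atTop, ∀ m ∈ Finset.range n,
      greedy K (occupiedCells X K ω) m = ⌊(K : ℝ) * starPoint X m ω⌋₊ :=
    (Filter.eventually_all_finset _).2 fun m _ =>
      eventually_greedy_occupiedCells_eq hnonneg hmono hlim m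
  filter_upwards [hstar, eventually_gt_atTop 0] with K hK hK0
  have hK' : (0 : ℝ) < K := by exact_mod_cast hK0
  rw [card_gapPositions _ _ fun m => (greedy_spec K (infinite_occupiedCells hlim hK0) m).1,
    Nat.cast_sum, Finset.sum_div]
  refine Finset.sum_congr rfl fun m hm => ?_
  rw [hK m hm]
  generalize ⌊(K : ℝ) * starPoint X m ω⌋₊ = a
  generalize ⌊(K : ℝ) * w⌋₊ = l
  have h1 : (a : ℝ) / K + 1 = (a + K : ℕ) / K := by
    push_cast
    field_simp
  rw [h1, min_div_div_right hK'.le, ← Nat.cast_min, ← add_div, ← sub_div]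
  generalize min (a + K) l = t
  -- Truncated subtraction of naturals corresponds to the maximum with 0 on the real side.
  rcases le_total (a + 1) t with h | h
  · rw [Nat.cast_sub h, max_eq_left]
    · push_cast
      ring
    · have : ((a + 1 : ℕ) : ℝ) ≤ t := by exact_mod_cast h
      push_cast at this
      exact div_nonneg (by linarith) hK'.le
  · rw [Nat.sub_eq_zero_of_le h, max_eq_right]
    · simp
    · have : (t : ℝ) ≤ ((a + 1 : ℕ) : ℝ) := by exact_mod_cast h
      push_cast at this
      exact div_nonpos_of_nonpos_of_nonneg (by linarith) hK'.le

end Star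

/-! ### Conditional probability of an empty Gilbert graph -/

section Conditional

open Filter Topology

variable {Ω : Type*} {X : ℕ → Ω → ℝ} {ω : Ω}

/-- Gaps before the last star point in the window have full length 1, the last one is cut at `w`,
and later ones contribute 0. If the first point exceeds `w`, the conventions `I_* = 0` and `X_* = w`
also give 0. -/
lemma gapLength_starPoint_eq (hnonneg : ∀ i ω, 0 ≤ X i ω) (hmono : Monotone fun i => X i ω)
    (hlim : Tendsto (fun i => X i ω) atTop atTop) {w : ℝ} {n : ℕ} (hn : w < n) :
    gapLength w n (fun m => starPoint X m ω) =
      max ((starLastIndex X w ω : ℝ) - 1) 0 + min (w - starLastPoint X w ω) 1 := by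
  have hstrict := strictMono_starPoint hmono hlim
  rw [starLastPoint, starLastIndex]
  split_ifs with h0
  · have : gapLength w n (fun m => starPoint X m ω) = 0 := by
      refine Finset.sum_eq_zero fun m _ => max_eq_right ?_
      have h1 : X 0 ω ≤ starPoint X m ω := hstrict.monotone (Nat.zero_le m)
      have := min_le_right (starPoint X m ω + 1) w
      linarith
    rw [this]
    norm_num
  · obtain ⟨m, hm1, hm2⟩ := exists_starPoint_le_lt hnonneg hmono hlim (not_lt.1 h0)
    -- Star points are numbered from 0 here, but `I_*` counts from 1.
    have hlast : sSup {i : ℕ | 1 ≤ i ∧ starPoint X (i - 1) ω ≤ w} = m + 1 := by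
      refine IsGreatest.csSup_eq ⟨⟨by omega, by simpa using hm1⟩, ?_⟩
      rintro i ⟨hi, hiw⟩
      have := hstrict.lt_iff_lt.1 (hiw.trans_lt hm2)
      omega
    have hmn : m < n := by
      have := natCast_le_starPoint hnonneg hmono hlim m
      exact_mod_cast (show (m : ℝ) < n by linarith)
    have hsplit : gapLength w n (fun m => starPoint X m ω) =
        gapLength w (m + 1) (fun m => starPoint X m ω) := by
      refine (Finset.sum_subset (Finset.range_subset_range.2 hmn) fun k _ hk => max_eq_right ?_).symm
      have hle : starPoint X (m + 1) ω ≤ starPoint X k ω :=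
        hstrict.monotone (by simpa using hk)
      have := min_le_right (starPoint X k ω + 1) w
      linarith
    rw [hlast, hsplit, gapLength, Finset.sum_range_succ, Nat.add_sub_cancel]
    congr 1
    · rw [Finset.sum_congr rfl (g := fun _ => (1 : ℝ))]
      · simp
      · intro k hk
        have h1 := starPoint_add_one_le hmono hlim k
        have h2 : starPoint X (k + 1) ω ≤ starPoint X m ω :=
          hstrict.monotone (Finset.mem_range.1 hk)
        rw [min_eq_left (by linarith), add_sub_cancel_left, max_eq_left zero_le_one]
    · rw [max_eq_left, ← min_sub_sub_right, add_sub_cancel_left, min_comm]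
      exact sub_nonneg.2 (le_min (by linarith) hm1)

variable [MeasurableSpace Ω] {P : Measure Ω} {rate : ℝ≥0}

lemma continuous_gapLength (w : ℝ) (n : ℕ) : Continuous (gapLength w n) := by
  unfold gapLength
  fun_prop

lemma starSigmaAlgebra_eq_comap {Ω : Type*} (X : ℕ → Ω → ℝ) :
    starSigmaAlgebra X = MeasurableSpace.comap (fun ω m => starPoint X m ω) MeasurableSpace.pi := by
  simp only [starSigmaAlgebra, MeasurableSpace.pi, MeasurableSpace.comap_iSup,
    MeasurableSpace.comap_comp]
  rfl

namespace IsHomogeneousPoissonProcess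

/-- The limit `K → ∞` of `integral_indicator_voidGaps_mul`. Both integrands are bounded by `‖f‖`,
and continuity of `f` absorbs the rounding to the grid. -/
lemma integral_indicator_atMostEdges [IsProbabilityMeasure P]
    (hX : IsHomogeneousPoissonProcess P rate X)
    (hmono : ∀ ω, Monotone fun i => X i ω) {w : ℝ} (hw : 0 ≤ w) {n : ℕ} (hn : w < n)
    (f : BoundedContinuousFunction (Fin n → ℝ) ℝ) :
    ∫ ω, (atMostEdges X w 0).indicator (fun ω => f fun m => starPoint X m ω) ω ∂P =
      ∫ ω, Real.exp (-(rate * gapLength w n fun m => starPoint X m ω)) *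
        f (fun m => starPoint X m ω) ∂P := by
  have hS := fun K => measurableSet_mem_occupiedCells hX.measurable K
  have hpos : ∀ {ω}, Tendsto (fun i => X i ω) atTop atTop → ∀ m, 0 ≤ starPoint X m ω :=
    fun h m => m.cast_nonneg.trans (natCast_le_starPoint hX.nonneg (hmono _) h m)
  have hdisc : ∀ ω, Tendsto (fun i => X i ω) atTop atTop →
      Tendsto (fun K : ℕ => f fun m : Fin n => (greedy K (occupiedCells X K ω) m : ℝ) / K) atTop
        (𝓝 (f fun m => starPoint X m ω)) := by
    intro ω hω
    refine (f.continuous.tendsto _).comp (tendsto_pi_nhds.2 fun m => ?_)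
    have h1 : Tendsto (fun K : ℕ => (⌊(K : ℝ) * starPoint X m ω⌋₊ : ℝ) / K) atTop
        (𝓝 (starPoint X m ω)) := by
      simpa only [mul_comm, Function.comp_def] using
        (tendsto_nat_floor_mul_div_atTop (hpos hω m)).comp tendsto_natCast_atTop_atTop
    refine h1.congr' ?_
    filter_upwards [eventually_greedy_occupiedCells_eq hX.nonneg (hmono ω) hω m] with K hK
    rw [hK]
  have hmeas_f : ∀ K, Measurable fun ω =>
      f fun m : Fin n => (greedy K (occupiedCells X K ω) m : ℝ) / K := fun K =>
    measurable_comp_greedy K n (hS K) (fun y => f fun m : Fin n => (y m : ℝ) / K)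
      fun y z h => by simp only [h _ (Fin.is_lt _)]
  have hleft : Tendsto (fun K : ℕ => ∫ ω, (voidGaps K ⌊(K : ℝ) * w⌋₊ n (occupiedCells X K)).indicator
        (fun ω => f fun m : Fin n => (greedy K (occupiedCells X K ω) m : ℝ) / K) ω ∂P) atTop
      (𝓝 (∫ ω, (atMostEdges X w 0).indicator (fun ω => f fun m => starPoint X m ω) ω ∂P)) := by
    refine tendsto_integral_of_dominated_convergence (fun _ => ‖f‖) (fun K => ?_)
      (integrable_const _) (fun K => ae_of_all _ fun ω => ?_) ?_
    · exact ((hmeas_f K).indicator (measurableSet_voidGaps _ _ _ (hS K))).aestronglyMeasurable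
    · exact (norm_indicator_le_norm_self _ _).trans (f.norm_coe_le_norm _)
    · filter_upwards [hX.ae_tendsto_atTop hmono, hX.ae_notMem_singleton hw, hX.ae_ne_add_one]
        with ω h1 h2 h3
      have hev := eventually_mem_voidGaps_iff hX.nonneg (hmono ω) h1 h2 h3 hn
      by_cases hE : ω ∈ atMostEdges X w 0
      · rw [Set.indicator_of_mem hE]
        refine (hdisc ω h1).congr' ?_
        filter_upwards [hev] with K hK
        rw [Set.indicator_of_mem (hK.2 hE)]
      · rw [Set.indicator_of_notMem hE]
        refine tendsto_const_nhds.congr' ?_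
        filter_upwards [hev] with K hK
        rw [Set.indicator_of_notMem fun h => hE (hK.1 h)]
  have hright : Tendsto (fun K : ℕ => ∫ ω, Real.exp (-(rate / K)) ^
        (gapPositions K ⌊(K : ℝ) * w⌋₊ n (greedy K (occupiedCells X K ω))).card *
        f (fun m : Fin n => (greedy K (occupiedCells X K ω) m : ℝ) / K) ∂P) atTop
      (𝓝 (∫ ω, Real.exp (-(rate * gapLength w n fun m => starPoint X m ω)) *
        f (fun m => starPoint X m ω) ∂P)) := by
    refine tendsto_integral_of_dominated_convergence (fun _ => ‖f‖) (fun K => ?_)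
      (integrable_const _) (fun K => ae_of_all _ fun ω => ?_) ?_
    · refine Measurable.aestronglyMeasurable (Measurable.mul ?_ (hmeas_f K))
      exact measurable_comp_greedy K n (hS K) (fun y => Real.exp (-(rate / K)) ^
        (gapPositions K ⌊(K : ℝ) * w⌋₊ n y).card) fun y z h => by rw [gapPositions_congr h]
    · rw [norm_mul, norm_pow, Real.norm_eq_abs, Real.abs_exp]
      refine (mul_le_of_le_one_left (norm_nonneg _) (pow_le_one₀ (Real.exp_pos _).le ?_)).trans
        (f.norm_coe_le_norm _)
      rw [Real.exp_le_one_iff, neg_nonpos]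
      positivity
    · filter_upwards [hX.ae_tendsto_atTop hmono] with ω h1
      refine Tendsto.mul ?_ (hdisc ω h1)
      have h2 := (tendsto_card_gapPositions_div hX.nonneg (hmono ω) h1 hw n).const_mul (rate : ℝ)
      refine ((Real.continuous_exp.tendsto _).comp h2.neg).congr fun K => ?_
      rw [Function.comp_apply, ← Real.exp_nat_mul]
      congr 1
      ring
  refine tendsto_nhds_unique (hleft.congr' ?_) hright
  filter_upwards [eventually_gt_atTop 0] with K hK
  have h := integral_indicator_voidGaps_mul hK ⌊(K : ℝ) * w⌋₊ n (hS K)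
    ((hX.ae_tendsto_atTop hmono).mono fun ω hω => infinite_occupiedCells hω hK)
    ENNReal.ofReal_ne_top (hX.measure_occupiedCells hK) (fun y => f fun m => (y m : ℝ) / K)
  rwa [ENNReal.toReal_ofReal (Real.exp_pos _).le] at h

lemma map_restrict_atMostEdges [IsProbabilityMeasure P]
    (hX : IsHomogeneousPoissonProcess P rate X)
    (hmono : ∀ ω, Monotone fun i => X i ω) {w : ℝ} (hw : 0 ≤ w) {n : ℕ} (hn : w < n) :
    (P.restrict (atMostEdges X w 0)).map (fun ω (m : Fin n) => starPoint X m ω) =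
      (P.withDensity fun ω => ENNReal.ofReal
        (Real.exp (-(rate * gapLength w n fun m => starPoint X m ω)))).map
          (fun ω (m : Fin n) => starPoint X m ω) := by
  have hT : Measurable fun ω (m : Fin n) => starPoint X m ω :=
    measurable_pi_lambda _ fun m => measurable_starPoint hX.measurable m
  have hg : Measurable fun ω => ENNReal.ofReal
      (Real.exp (-(rate * gapLength w n fun m => starPoint X m ω))) := by
    have : Measurable fun ω => gapLength w n fun m => starPoint X m ω :=
      (continuous_gapLength w n).measurable.comp
        (measurable_pi_lambda _ fun m => measurable_starPoint hX.measurable m)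
    fun_prop
  have : IsFiniteMeasure (P.withDensity fun ω => ENNReal.ofReal
      (Real.exp (-(rate * gapLength w n fun m => starPoint X m ω)))) := by
    refine isFiniteMeasure_withDensity ?_
    refine ne_top_of_le_ne_top (b := ∫⁻ _, 1 ∂P) (by simp) (lintegral_mono fun ω => ?_)
    rw [← ENNReal.ofReal_one]
    refine ENNReal.ofReal_le_ofReal (Real.exp_le_one_iff.2 (neg_nonpos.2 ?_))
    exact mul_nonneg rate.2 (gapLength_nonneg _ _ _)
  refine ext_of_forall_integral_eq_of_IsFiniteMeasure fun f => ?_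
  rw [integral_map hT.aemeasurable f.continuous.aestronglyMeasurable,
    integral_map hT.aemeasurable f.continuous.aestronglyMeasurable,
    integral_withDensity_eq_integral_toReal_smul hg (ae_of_all _ fun _ => ENNReal.ofReal_lt_top),
    ← integral_indicator (measurableSet_atMostEdges_zero hX.measurable hX.nonneg w),
    hX.integral_indicator_atMostEdges hmono hw hn f]
  simp [ENNReal.toReal_ofReal (Real.exp_pos _).le]

/-- Lets the number of observed star points grow while the density stays the same. -/
lemma withDensity_gapLength_congr (hX : IsHomogeneousPoissonProcess P rate X)
    (hmono : ∀ ω, Monotone fun i => X i ω) {w : ℝ} {n k : ℕ} (hn : w < n) (hk : w < k) :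
    (P.withDensity fun ω => ENNReal.ofReal
        (Real.exp (-(rate * gapLength w n fun m => starPoint X m ω)))) =
      P.withDensity fun ω => ENNReal.ofReal
        (Real.exp (-(rate * gapLength w k fun m => starPoint X m ω))) := by
  refine withDensity_congr_ae ?_
  filter_upwards [hX.ae_tendsto_atTop hmono] with ω hω
  rw [gapLength_starPoint_eq hX.nonneg (hmono ω) hω hn,
    gapLength_starPoint_eq hX.nonneg (hmono ω) hω hk]

/-- Finite measures on sequence space are determined by their finite-dimensional marginals. -/
lemma map_restrict_atMostEdges_seq [IsProbabilityMeasure P]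
    (hX : IsHomogeneousPoissonProcess P rate X)
    (hmono : ∀ ω, Monotone fun i => X i ω) {w : ℝ} (hw : 0 ≤ w) {n : ℕ} (hn : w < n) :
    (P.restrict (atMostEdges X w 0)).map (fun ω m => starPoint X m ω) =
      (P.withDensity fun ω => ENNReal.ofReal
        (Real.exp (-(rate * gapLength w n fun m => starPoint X m ω)))).map
          (fun ω m => starPoint X m ω) := by
  have hT : Measurable fun ω m => starPoint X m ω :=
    measurable_pi_lambda _ fun m => measurable_starPoint hX.measurable m
  have hagree : ∀ I : Finset ℕ,
      ((P.restrict (atMostEdges X w 0)).map (fun ω m => starPoint X m ω)).map I.restrict =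
        ((P.withDensity fun ω => ENNReal.ofReal
          (Real.exp (-(rate * gapLength w n fun m => starPoint X m ω)))).map
            (fun ω m => starPoint X m ω)).map I.restrict := by
    intro I
    obtain ⟨N, hN⟩ := I.exists_nat_subset_range
    -- Taking `max n N` points keeps the count above `w` and covers every coordinate in `I`.
    have hk : w < (max n N : ℕ) := hn.trans_le (by exact_mod_cast le_max_left n N)
    have hlt : ∀ i : I, (i : ℕ) < max n N := fun i =>
      (Finset.mem_range.1 (hN i.2)).trans_le (le_max_right n N)
    have hTk : Measurable fun ω (m : Fin (max n N)) => starPoint X m ω :=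
      measurable_pi_lambda _ fun m => measurable_starPoint hX.measurable m
    have hproj : Measurable fun (x : Fin (max n N) → ℝ) (i : I) => x ⟨i, hlt i⟩ :=
      measurable_pi_lambda _ fun i => measurable_pi_apply _
    rw [hX.withDensity_gapLength_congr hmono hn hk, Measure.map_map I.measurable_restrict hT,
      Measure.map_map I.measurable_restrict hT]
    have := congrArg (Measure.map fun (x : Fin (max n N) → ℝ) (i : I) => x ⟨i, hlt i⟩)
      (hX.map_restrict_atMostEdges hmono hw hk)
    rw [Measure.map_map hproj hTk, Measure.map_map hproj hTk] at this
    exact this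
  exact IsProjectiveLimit.unique (P := fun I => ((P.restrict (atMostEdges X w 0)).map
    (fun ω m => starPoint X m ω)).map I.restrict) (fun _ => rfl) fun I => (hagree I).symm

end IsHomogeneousPoissonProcess

end Conditional

theorem theorem2 {Ω : Type*} [MeasurableSpace Ω] (P : Measure Ω) [IsProbabilityMeasure P]
    (rate : ℝ≥0) (hrate : 0 < rate) (X : ℕ → Ω → ℝ)
    (hX : IsHomogeneousPoissonProcess P rate X) (hmono : ∀ ω, Monotone (fun i => X i ω))
    (w : ℝ) (hw : 1 ≤ w) :
    P⟦atMostEdges X w 0 | starSigmaAlgebra X⟧ =ᵐ[P] fun ω =>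
      Real.exp (-((rate : ℝ) *
        (max ((starLastIndex X w ω : ℝ) - 1) 0 + min (w - starLastPoint X w ω) 1))) := by
  obtain ⟨n, hn⟩ := exists_nat_gt w
  have hw0 : 0 ≤ w := zero_le_one.trans hw
  have hE := measurableSet_atMostEdges_zero hX.measurable hX.nonneg w
  have hT : Measurable fun ω m => starPoint X m ω :=
    measurable_pi_lambda _ fun m => measurable_starPoint hX.measurable m
  have hle : starSigmaAlgebra X ≤ ‹MeasurableSpace Ω› := by
    rw [starSigmaAlgebra_eq_comap]
    exact hT.comap_le
  have hψ : Measurable fun x : ℕ → ℝ => Real.exp (-(rate * gapLength w n x)) := by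
    have := (continuous_gapLength w n).measurable
    fun_prop
  have hint : Integrable (fun ω => Real.exp (-(rate * gapLength w n fun m => starPoint X m ω)))
      P := by
    refine Integrable.of_bound (hψ.comp hT).aestronglyMeasurable 1 (ae_of_all _ fun ω => ?_)
    rw [Real.norm_eq_abs, Real.abs_exp, Real.exp_le_one_iff, neg_nonpos]
    exact mul_nonneg rate.2 (gapLength_nonneg _ _ _)
  have hae : (fun ω => Real.exp (-(rate * gapLength w n fun m => starPoint X m ω))) =ᵐ[P]
      fun ω => Real.exp (-((rate : ℝ) *
        (max ((starLastIndex X w ω : ℝ) - 1) 0 + min (w - starLastPoint X w ω) 1))) := by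
    filter_upwards [hX.ae_tendsto_atTop hmono] with ω hω
    rw [gapLength_starPoint_eq hX.nonneg (hmono ω) hω hn]
  refine Filter.EventuallyEq.trans (Filter.EventuallyEq.symm ?_) hae
  -- The equality of measures on sequence space, evaluated at `B`, is the defining identity of the
  -- conditional expectation on the preimage of `B`.
  refine ae_eq_condExp_of_forall_setIntegral_eq hle ((integrable_const _).indicator hE)
    (fun _ _ _ => hint.integrableOn) (fun s hs _ => ?_) ?_
  · rw [starSigmaAlgebra_eq_comap] at hs
    obtain ⟨B, hB, rfl⟩ := hs
    have hB' := hT hB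
    have h := congrArg (fun μ : Measure (ℕ → ℝ) => (μ B).toReal)
      (hX.map_restrict_atMostEdges_seq hmono hw0 hn)
    simp only [Measure.map_apply hT hB, Measure.restrict_apply hB', withDensity_apply _ hB'] at h
    rw [integral_indicator hE, Measure.restrict_restrict hE, setIntegral_const, smul_eq_mul,
      mul_one, measureReal_def, Set.inter_comm, h, integral_eq_lintegral_of_nonneg_ae
        (ae_of_all _ fun _ => (Real.exp_pos _).le) hint.aestronglyMeasurable.restrict]
  · refine StronglyMeasurable.aestronglyMeasurable (Measurable.stronglyMeasurable ?_)
    rw [starSigmaAlgebra_eq_comap]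
    exact hψ.comp (comap_measurable _)
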